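/- Let $\alpha,\beta\in\mathbb C$ with $\Re(\alpha\overline\beta)>0$, and put $M=1-\Re\frac{\beta}{\alpha}$. Write $D_r=\{z\in\mathbb C:|z|<r\}$ and $\mathbb D=D_1$. Let $\mathcal A_{\alpha,\beta}$ be the set of all holomorphic $F:\mathbb D\to\mathbb C$ for which there is a holomorphic $\omega:\mathbb D\to\mathbb D$ with $\omega(0)=0$ and $$F(z)=z\left(\beta+\frac{\alpha\,\omega(z)}{1-\omega(z)}\right)\qquad(z\in\mathbb D),$$ that is, $F(z)/z\prec\beta+\frac{\alpha z}{1-z}$. Each $F\in\mathcal A_{\alpha,\beta}$ has a holomorphic inverse $G=F^{-1}$ near the origin, with $G(0)=0$. Let $\mathcal B_{\alpha,\beta}$ be the set of all these inverses. Define $$R=\begin{cases}|\alpha|\left(\frac12-M\right),&\Re\frac\beta\alpha>\frac34,\\[2pt] |\alpha|\left(1-\sqrt M\right)^2,&\Re\frac\beta\alpha\le\frac34,\end{cases}\qquad R_1=\begin{cases}1,&\Re\frac\beta\alpha>\frac34,\\[2pt] \frac1{\sqrt M}-1,&\Re\frac\beta\alpha\le\frac34,\end{cases}$$ $$R_2=\frac{RR_1}{R_1|\beta|+\sqrt{R_1^2|\beta|^2-R^2}}.$$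 Then every $G\in\mathcal B_{\alpha,\beta}$ extends to a univalent (holomorphic and injective) function on $D_R$, again denoted $G$. This extension satisfies $F(G(w))=w$ for all $w\in D_R$, for every $F\in\mathcal A_{\alpha,\beta}$ whose inverse near the origin is $G$. Moreover $$G(D_R)\subset D_{R_1}\qquad\text{and}\qquad G(D_R)\supset D_{R_2}.$$ -/

import Mathlib

open Metric Set Filter Topology

noncomputable section

namespace InverseClass

/-- The linear fractional function `ψ(z) = β + α z / (1 - z)` on the unit disk. -/
def psi (α β z : ℂ) : ℂ := β + α * z / (1 - z)

/-- Holomorphic self-mappings of the open unit disk that vanish at the origin. -/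
def SchwarzMap (ω : ℂ → ℂ) : Prop :=
  DifferentiableOn ℂ ω (ball 0 1) ∧ MapsTo ω (ball 0 1) (ball 0 1) ∧ ω 0 = 0

/-- The class of functions `F`, holomorphic in the unit disk, with `F(z)/z` subordinate to `ψ`,
that is, `F(z) = z ψ(ω(z))` for some `ω`. Values outside the unit disk are irrelevant. -/
def classA (α β : ℂ) : Set (ℂ → ℂ) :=
  {F | DifferentiableOn ℂ F (ball 0 1) ∧
    ∃ ω : ℂ → ℂ, SchwarzMap ω ∧ ∀ z ∈ ball (0 : ℂ) 1, F z = z * psi α β (ω z)}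

/-- `G` is (a representative of) the inverse function `F⁻¹` near the origin: it is holomorphic
near `0`, vanishes at `0`, and is a two-sided inverse of `F` near `0`. -/
def IsInverseAtZero (F G : ℂ → ℂ) : Prop :=
  AnalyticAt ℂ G 0 ∧ G 0 = 0 ∧ (∀ᶠ w in 𝓝 (0 : ℂ), F (G w) = w) ∧
    ∀ᶠ z in 𝓝 (0 : ℂ), G (F z) = z

/-- The class of inverse functions of members of `classA α β`. -/
def classB (α β : ℂ) : Set (ℂ → ℂ) :=
  {G | ∃ F ∈ classA α β, IsInverseAtZero F G}

/-- `M = 1 - Re (β / α)`. -/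
def paramM (α β : ℂ) : ℝ := 1 - (β / α).re

/-- The radius of univalence `R`. -/
def radiusR (α β : ℂ) : ℝ :=
  if 3 / 4 < (β / α).re then ‖α‖ * (1 / 2 - paramM α β)
  else ‖α‖ * (1 - √(paramM α β)) ^ 2

/-- The radius `R₁` of the disk containing the image. -/
def radiusR₁ (α β : ℂ) : ℝ :=
  if 3 / 4 < (β / α).re then 1 else 1 / √(paramM α β) - 1

/-- The radius `R₂` of the covered disk. -/
def radiusR₂ (α β : ℂ) : ℝ :=
  radiusR α β * radiusR₁ α β /
    (radiusR₁ α β * ‖β‖ + √((radiusR₁ α β) ^ 2 * ‖β‖ ^ 2 - (radiusR α β) ^ 2))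

end InverseClass

end

namespace InverseClass

open Asymptotics

/-! Write `F z = z * p z` with `p = psi α β ∘ ω`. The Schwarz lemma `‖ω z‖ ≤ ‖z‖` gives two-sided
bounds on `‖p z‖` in terms of `‖z‖` (`classA_factor`). The lower bound gives `‖p‖ ≥ R / R₁` on the
`R₁`-disk, so the inverse equation `H = w / p(H)` can be solved by iteration from `0` on the whole
`R`-disk, with values in the `R₁`-disk (`exists_holomorphic_fixedPoint`). The solution is injective
because `F` undoes it. The upper bound shows that `F` maps the `R₂`-disk into the `R`-disk
(`radiusR₂_spec`). There `H ∘ F` is defined and is the identity near `0`, hence everywhere by the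
identity theorem, so `H` covers the `R₂`-disk. -/

/-- The iterates of `g ↦ (w ↦ w q(g(w)))`, starting at the zero function. -/
def iter (q : ℂ → ℂ) : ℕ → ℂ → ℂ
  | 0, _ => 0
  | n + 1, w => w * q (iter q n w)

/-! ### Solving `H = w q(H)` by iteration. -/

section Iteration

variable {q : ℂ → ℂ} {a R : ℝ}

lemma norm_iter_le (ha : 0 < a) (hR : 0 < R) (hq : ∀ z ∈ ball (0 : ℂ) a, ‖q z‖ ≤ a / R)
    (n : ℕ) {w : ℂ} (hw : w ∈ ball (0 : ℂ) R) : ‖iter q n w‖ ≤ ‖w‖ * (a / R) := by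
  have hw' : ‖w‖ < R := by simpa using hw
  have hlt : ‖w‖ * (a / R) < a := by
    calc ‖w‖ * (a / R) < R * (a / R) := by gcongr
      _ = a := by field_simp
  induction n with
  | zero => simp only [iter, norm_zero]; positivity
  | succ n ih =>
    rw [iter, norm_mul]
    gcongr
    exact hq _ (by simpa using ih.trans_lt hlt)

lemma iter_mem_ball (ha : 0 < a) (hR : 0 < R) (hq : ∀ z ∈ ball (0 : ℂ) a, ‖q z‖ ≤ a / R)
    (n : ℕ) {w : ℂ} (hw : w ∈ ball (0 : ℂ) R) : iter q n w ∈ ball (0 : ℂ) a := by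
  have hw' : ‖w‖ < R := by simpa using hw
  have hlt : ‖w‖ * (a / R) < a := by
    calc ‖w‖ * (a / R) < R * (a / R) := by gcongr
      _ = a := by field_simp
  simpa using (norm_iter_le ha hR hq n hw).trans_lt hlt

lemma iter_apply_zero (n : ℕ) : iter q n 0 = 0 := by
  cases n <;> simp [iter]

lemma differentiableOn_iter (ha : 0 < a) (hR : 0 < R)
    (hq : ∀ z ∈ ball (0 : ℂ) a, ‖q z‖ ≤ a / R) (hd : DifferentiableOn ℂ q (ball 0 a)) (n : ℕ) :
    DifferentiableOn ℂ (iter q n) (ball 0 R) := by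
  induction n with
  | zero => exact differentiableOn_const 0
  | succ n ih =>
    exact differentiableOn_id.mul (hd.comp ih fun w hw => iter_mem_ball ha hR hq n hw)

/-- Each step gains one order of vanishing: `q` is Lipschitz near `0`, and the factor `w` supplies
the extra power. -/
lemma iter_succ_sub_isLittleO (ha : 0 < a) (hR : 0 < R)
    (hq : ∀ z ∈ ball (0 : ℂ) a, ‖q z‖ ≤ a / R) (hd : DifferentiableOn ℂ q (ball 0 a)) (n : ℕ) :
    (fun w => iter q (n + 1) w - iter q n w) =o[𝓝 0] fun w : ℂ => ‖w‖ ^ n := by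
  have hcont : ∀ k, Tendsto (iter q k) (𝓝 0) (𝓝 0) := fun k => by
    have := ((differentiableOn_iter ha hR hq hd k).continuousOn.continuousAt
      (ball_mem_nhds _ hR)).tendsto
    rwa [iter_apply_zero] at this
  induction n with
  | zero =>
    simpa using (hcont 1).sub (hcont 0)
  | succ n ih =>
    have hs : HasStrictDerivAt q (deriv q 0) 0 :=
      ((hd.analyticAt (ball_mem_nhds _ ha)).hasStrictDerivAt)
    have hlip := hs.hasStrictFDerivAt.isBigO_sub.comp_tendsto
      ((hcont (n + 1)).prodMk_nhds (hcont n))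
    have h := (isBigO_refl (fun w : ℂ => w) (𝓝 0)).norm_right.mul_isLittleO
      (hlip.trans_isLittleO ih)
    refine h.congr (fun w => ?_) fun w => ?_
    · simp [iter, mul_sub]
    · rw [pow_succ']

/-- The higher-order Schwarz lemma turns vanishing at `0` and the crude bound `2 * a` into geometric
decay, so `q` need not be a contraction. -/
lemma norm_iter_succ_sub_le (ha : 0 < a) (hR : 0 < R)
    (hq : ∀ z ∈ ball (0 : ℂ) a, ‖q z‖ ≤ a / R) (hd : DifferentiableOn ℂ q (ball 0 a)) (n : ℕ)
    {w : ℂ} (hw : w ∈ ball (0 : ℂ) R) :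
    ‖iter q (n + 1) w - iter q n w‖ ≤ 2 * a * (‖w‖ / R) ^ (n + 1) := by
  have h := Complex.dist_le_mul_div_pow_of_mapsTo_ball_of_isLittleO (n := n) (R₂ := 2 * a)
    ((differentiableOn_iter ha hR hq hd (n + 1)).sub (differentiableOn_iter ha hR hq hd n))
    (fun z hz => ?_) ?_ hw
  · simpa [iter_apply_zero] using h
  · have h1 := iter_mem_ball ha hR hq (n + 1) hz
    have h2 := iter_mem_ball ha hR hq n hz
    simp only [mem_ball_zero_iff] at h1 h2
    simp only [Pi.sub_apply, iter_apply_zero, sub_zero, mem_closedBall, dist_zero_right]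
    linarith [norm_sub_le (iter q (n + 1) z) (iter q n z)]
  · simpa [iter_apply_zero] using iter_succ_sub_isLittleO ha hR hq hd n

/-- If `q` is holomorphic on the disk of radius `a` and bounded there by `a / R`, then the
equation `H = w q(H)` has a holomorphic solution on the disk of radius `R`. -/
lemma exists_holomorphic_fixedPoint (ha : 0 < a) (hR : 0 < R)
    (hq : ∀ z ∈ ball (0 : ℂ) a, ‖q z‖ ≤ a / R) (hd : DifferentiableOn ℂ q (ball 0 a)) :
    ∃ H : ℂ → ℂ, DifferentiableOn ℂ H (ball 0 R) ∧
      ∀ w ∈ ball (0 : ℂ) R, H w ∈ ball (0 : ℂ) a ∧ H w = w * q (H w) := by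
  set d : ℕ → ℂ → ℂ := fun n w => iter q (n + 1) w - iter q n w with hd_def
  have hsummable : ∀ r : ℝ, 0 ≤ r → r < R → Summable fun n : ℕ => 2 * a * (r / R) ^ (n + 1) :=
    fun r hr hrR => by
      have : Summable fun n : ℕ => (r / R) ^ n :=
        summable_geometric_of_lt_one (by positivity) ((div_lt_one hR).2 hrR)
      exact ((summable_nat_add_iff 1).2 this).mul_left _
  refine ⟨fun w => ∑' n, d n w, fun w hw => ?_, fun w hw => ?_⟩
  -- The series is dominated uniformly only on strictly smaller disks.
  · obtain ⟨r, hwr, hrR⟩ := exists_between (show ‖w‖ < R by simpa using hw)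
    have hr : 0 ≤ r := (norm_nonneg w).trans hwr.le
    have hsub : ball (0 : ℂ) r ⊆ ball 0 R := ball_subset_ball hrR.le
    have hdiff := Complex.differentiableOn_tsum_of_summable_norm (F := d) (U := ball 0 r)
      (hsummable r hr hrR)
      (fun n => ((differentiableOn_iter ha hR hq hd (n + 1)).sub
        (differentiableOn_iter ha hR hq hd n)).mono hsub) isOpen_ball
      (fun n z hz => (norm_iter_succ_sub_le ha hR hq hd n (hsub hz)).trans (by
        have : ‖z‖ ≤ r := by simpa using (mem_ball.1 hz).le
        gcongr))
    exact (hdiff.differentiableAt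
      (isOpen_ball.mem_nhds (by simpa using hwr))).differentiableWithinAt
  · have hwR : ‖w‖ < R := by simpa using hw
    have hs : Summable fun n => d n w :=
      Summable.of_norm_bounded (hsummable ‖w‖ (norm_nonneg w) hwR)
        fun n => norm_iter_succ_sub_le ha hR hq hd n hw
    -- The series telescopes to the iterates, since iterate `0` is the zero function.
    have hlim : Tendsto (fun n => iter q n w) atTop (𝓝 (∑' n, d n w)) := by
      refine hs.hasSum.tendsto_sum_nat.congr fun n => ?_
      rw [Finset.sum_range_sub (fun n => iter q n w)]
      simp [iter]
    have hmem : ∑' n, d n w ∈ ball (0 : ℂ) a := by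
      have hle : ‖∑' n, d n w‖ ≤ ‖w‖ * (a / R) :=
        le_of_tendsto hlim.norm (Eventually.of_forall fun n => norm_iter_le ha hR hq n hw)
      have hlt : ‖w‖ * (a / R) < a := by
        calc ‖w‖ * (a / R) < R * (a / R) := by gcongr
          _ = a := by field_simp
      simpa using hle.trans_lt hlt
    refine ⟨hmem, tendsto_nhds_unique ((tendsto_add_atTop_iff_nat 1).2 hlim) ?_⟩
    exact ((hd.continuousOn.continuousAt (isOpen_ball.mem_nhds hmem)).tendsto.comp
      hlim).const_mul w

end Iteration

/-! ### Uniqueness of local inverses. -/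

section LocalInverse

variable {F : ℂ → ℂ}

/-- A function with nonzero strict derivative at `0` has at most one continuous local right
inverse there, and every such right inverse is also a left inverse. -/
lemma exists_localInverse_unique {β : ℂ} (hβ : β ≠ 0) (hF : HasStrictDerivAt F β 0)
    (hF0 : F 0 = 0) :
    ∃ g : ℂ → ℂ, ∀ H : ℂ → ℂ, ContinuousAt H 0 → H 0 = 0 → (∀ᶠ w in 𝓝 0, F (H w) = w) →
      H =ᶠ[𝓝 0] g ∧ ∀ᶠ z in 𝓝 0, H (F z) = z := by
  have hleft := (hF.hasStrictFDerivAt_equiv hβ).eventually_left_inverse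
  refine ⟨(hF.hasStrictFDerivAt_equiv hβ).localInverse F _ 0, fun H hc h0 hH => ?_⟩
  have ht : Tendsto H (𝓝 0) (𝓝 0) := by simpa [ContinuousAt, h0] using hc
  have hFt : Tendsto F (𝓝 0) (𝓝 0) := by
    simpa [ContinuousAt, hF0] using hF.hasDerivAt.continuousAt
  have heq : H =ᶠ[𝓝 0] (hF.hasStrictFDerivAt_equiv hβ).localInverse F _ 0 := by
    filter_upwards [ht.eventually hleft, hH] with w h1 h2
    rw [h2] at h1
    exact h1.symm
  refine ⟨heq, ?_⟩
  filter_upwards [hFt.eventually heq, hleft] with z h1 h2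
  rw [h1, h2]

end LocalInverse

/-! ### Bounds for `psi` and the three radii. -/

section Estimates

/-- The quotient is `1 / (1 - ω) - 1`, and `ω ↦ 1 / (1 - ω)` sends the disk of radius `r` to the
disk with diameter `[1 / (1 + r), 1 / (1 - r)]`. -/
lemma re_div_one_sub_ge {ω : ℂ} {r : ℝ} (hω : ‖ω‖ ≤ r) (hr : r < 1) :
    1 / (1 + r) - 1 ≤ (ω / (1 - ω)).re := by
  have hr0 : 0 ≤ r := (norm_nonneg ω).trans hω
  have hne : 1 - ω ≠ 0 := fun h => by
    have : ω = 1 := (sub_eq_zero.1 h).symm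
    rw [this, norm_one] at hω
    linarith
  have h1 : ω / (1 - ω) = (1 - ω)⁻¹ - 1 := by field_simp; ring
  have hpos : 0 < Complex.normSq (1 - ω) := Complex.normSq_pos.2 hne
  rw [h1, Complex.sub_re, Complex.inv_re, Complex.one_re]
  refine sub_le_sub_right ?_ 1
  rw [div_le_div_iff₀ (by linarith) hpos]
  have hx : |ω.re| ≤ r := (Complex.abs_re_le_norm ω).trans hω
  have hn : ω.re * ω.re + ω.im * ω.im ≤ r ^ 2 := by
    have := Complex.sq_norm ω
    rw [Complex.normSq_apply] at this
    rw [← this]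
    gcongr
  rw [Complex.normSq_apply]
  simp only [Complex.sub_re, Complex.sub_im, Complex.one_re, Complex.one_im]
  nlinarith [mul_nonneg (show 0 ≤ r + ω.re by linarith [neg_le_of_abs_le hx])
    (show 0 ≤ 1 - r by linarith)]

variable {α β : ℂ}

lemma psi_eq (hα : α ≠ 0) (ω : ℂ) : psi α β ω = α * (β / α + ω / (1 - ω)) := by
  rw [psi]; field_simp

lemma norm_psi_ge (hα : α ≠ 0) {ω : ℂ} {r : ℝ} (hω : ‖ω‖ ≤ r) (hr : r < 1) :
    ‖α‖ * (1 / (1 + r) - paramM α β) ≤ ‖psi α β ω‖ := by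
  rw [psi_eq hα, norm_mul]
  gcongr
  refine le_trans ?_ (Complex.re_le_norm _)
  rw [Complex.add_re, paramM]
  linarith [re_div_one_sub_ge hω hr]

lemma norm_psi_le {ω : ℂ} {r : ℝ} (hω : ‖ω‖ ≤ r) (hr : r < 1) :
    ‖psi α β ω‖ ≤ ‖β‖ + ‖α‖ * (r / (1 - r)) := by
  have h1 : 1 - r ≤ ‖1 - ω‖ := by
    have := norm_sub_norm_le (1 : ℂ) ω
    rw [norm_one] at this
    linarith
  rw [psi]
  refine (norm_add_le _ _).trans ?_
  have hr0 : 0 ≤ r := (norm_nonneg ω).trans hω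
  rw [norm_div, norm_mul, ← mul_div_assoc]
  gcongr

/-- `R₁` maximizes `r * (1 / (1 + r) - M)` on `(0, 1]`, and `R` is `‖α‖` times the maximum. The
critical point `1 / √M - 1` is at most `1` exactly when `M ≥ 1 / 4`; otherwise the maximum is at `r
= 1`. -/
lemma param_pos (hα : α ≠ 0) (hb : 0 < (β / α).re) :
    0 < radiusR₁ α β ∧ radiusR₁ α β ≤ 1 ∧ 0 < radiusR α β ∧
      radiusR α β / radiusR₁ α β = ‖α‖ * (1 / (1 + radiusR₁ α β) - paramM α β) := by
  have hα' : 0 < ‖α‖ := norm_pos_iff.2 hα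
  unfold radiusR₁ radiusR
  split_ifs with h
  · refine ⟨one_pos, le_rfl, ?_, by norm_num⟩
    exact mul_pos hα' (by rw [paramM]; linarith)
  · have hM : 1 / 4 ≤ paramM α β := by rw [paramM]; linarith
    have hM1 : paramM α β < 1 := by rw [paramM]; linarith
    have hsq : √(paramM α β) ^ 2 = paramM α β := Real.sq_sqrt (by linarith)
    have hnn := Real.sqrt_nonneg (paramM α β)
    rw [← hsq] at hM hM1 ⊢
    rw [Real.sqrt_sq hnn]
    set μ := √(paramM α β)
    have h1 : 1 / 2 ≤ μ := by nlinarith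
    have h2 : μ < 1 := by nlinarith
    have h0 : 0 < μ := by linarith
    have h3 : 1 < 1 / μ := by rw [lt_div_iff₀ h0]; linarith
    refine ⟨by linarith, ?_, ?_, ?_⟩
    · have : 1 / μ ≤ 2 := by rw [div_le_iff₀ h0]; linarith
      linarith
    · have : 0 < 1 - μ := by linarith
      positivity
    · have : 1 - μ ≠ 0 := by linarith
      have e : 1 / μ - 1 = (1 - μ) / μ := by field_simp
      rw [e]
      have e2 : 1 + (1 - μ) / μ = 1 / μ := by field_simp; ring
      rw [e2]
      field_simp

/-- The covering estimate for `Re (β / α) > 3 / 4`, in normalized form. -/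
lemma covering_estimate_large {c B ρ : ℝ} (hρ : 0 < ρ) (hρ1 : ρ ≤ 1) (hB : c + 1 / 2 ≤ B)
    (h : c * (1 + ρ ^ 2) = 2 * B * ρ) : ρ < 1 ∧ ρ * (B + ρ / (1 - ρ)) ≤ c := by
  have h1 : ρ ≤ c * (1 - ρ) ^ 2 := by nlinarith
  have hlt : ρ < 1 := lt_of_le_of_ne hρ1 fun e => by rw [e] at h1; norm_num at h1
  refine ⟨hlt, ?_⟩
  have hp : 0 < 1 - ρ := by linarith
  have h2 : ρ ^ 2 / (1 - ρ) ≤ c * (1 - ρ ^ 2) / 2 := by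
    rw [div_le_iff₀ hp]
    nlinarith [mul_le_mul_of_nonneg_right h1 (show 0 ≤ 1 + ρ by linarith)]
  have e : ρ * (B + ρ / (1 - ρ)) = ρ * B + ρ ^ 2 / (1 - ρ) := by field_simp
  rw [e]
  nlinarith

/-- The covering estimate for `Re (β / α) ≤ 3 / 4`, in normalized form. -/
lemma covering_estimate_small {μ B ρ : ℝ} (hμ : 1 / 2 ≤ μ) (hμ1 : μ < 1) (hρ : 0 < ρ)
    (hρ1 : ρ ≤ 1) (hB : 1 - μ ^ 2 ≤ B) (h : μ * (1 - μ) * (1 + ρ ^ 2) = 2 * B * ρ) :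
    (1 / μ - 1) * ρ < 1 ∧
      (1 / μ - 1) * ρ * (B + (1 / μ - 1) * ρ / (1 - (1 / μ - 1) * ρ)) ≤ (1 - μ) ^ 2 := by
  have hμ0 : 0 < μ := by linarith
  have hμ' : 0 < 1 - μ := by linarith
  have h1 : 2 * ρ ≤ μ * (1 - ρ) ^ 2 := by
    have : 0 ≤ (1 - μ) * (μ * (1 - ρ) ^ 2 - 2 * ρ) := by nlinarith
    nlinarith [nonneg_of_mul_nonneg_right this hμ']
  have hlt : ρ < 1 := lt_of_le_of_ne hρ1 fun e => by rw [e] at h1; norm_num at h1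
  have hden : 0 < μ - (1 - μ) * ρ := by nlinarith
  have hs : (1 / μ - 1) * ρ = (1 - μ) * ρ / μ := by field_simp
  have hs2 : 1 - (1 - μ) * ρ / μ = (μ - (1 - μ) * ρ) / μ := by field_simp
  refine ⟨?_, ?_⟩
  · rw [hs, div_lt_one hμ0]; linarith
  · have key : ρ ^ 2 / (μ - (1 - μ) * ρ) ≤ μ * (1 - ρ ^ 2) / 2 := by
      rw [div_le_iff₀ hden]
      have h3 : (1 - ρ) / 2 ≤ μ - (1 - μ) * ρ := by nlinarith
      have h4 : ρ * (1 - ρ) ≤ (1 + ρ) * (μ - (1 - μ) * ρ) := by nlinarith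
      have h5 : 2 * ρ * ((1 + ρ) * (μ - (1 - μ) * ρ)) ≤
          μ * (1 - ρ) ^ 2 * ((1 + ρ) * (μ - (1 - μ) * ρ)) :=
        mul_le_mul_of_nonneg_right h1 (by positivity)
      -- The extra factor `1 - ρ` produces the `μ * (1 - ρ) ^ 2` needed to apply `h5`.
      have h6 : 0 ≤ (1 - ρ) *
          (μ * (1 - ρ ^ 2) / 2 * (μ - (1 - μ) * ρ) - ρ ^ 2) := by nlinarith
      linarith [nonneg_of_mul_nonneg_right h6 (by linarith : 0 < 1 - ρ)]
    rw [hs, hs2]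
    have e : (1 - μ) * ρ / μ * (B + (1 - μ) * ρ / μ / ((μ - (1 - μ) * ρ) / μ)) =
        (1 - μ) / μ * (ρ * B + (1 - μ) * (ρ ^ 2 / (μ - (1 - μ) * ρ))) := by
      field_simp
    have e2 : (1 - μ) ^ 2 = (1 - μ) / μ * (μ * (1 - μ)) := by field_simp
    rw [e, e2]
    gcongr
    nlinarith [mul_le_mul_of_nonneg_left key hμ'.le]

lemma radiusR₂_spec (hα : α ≠ 0) (hb : 0 < (β / α).re) :
    0 < radiusR₂ α β ∧ radiusR₂ α β < 1 ∧
      radiusR₂ α β * (‖β‖ + ‖α‖ * (radiusR₂ α β / (1 - radiusR₂ α β))) ≤ radiusR α β := by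
  obtain ⟨hR1, hR1', hR, hrel⟩ := param_pos hα hb
  have hα' : 0 < ‖α‖ := norm_pos_iff.2 hα
  set B := ‖β‖ / ‖α‖ with hB_def
  have hβ : ‖β‖ = ‖α‖ * B := by rw [hB_def]; field_simp
  have hbB : 1 - paramM α β ≤ B := by
    rw [paramM, hB_def, ← norm_div]
    linarith [Complex.re_le_norm (β / α)]
  set P := radiusR₁ α β with hP
  set R := radiusR α β with hRdef
  set N := P * ‖β‖ with hN
  have hRN : R ≤ N := by
    have h1 : R = P * (‖α‖ * (1 / (1 + P) - paramM α β)) := by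
      rw [← hrel]; field_simp
    rw [h1, hN, hβ]
    have : 1 / (1 + P) ≤ 1 := by rw [div_le_one (by linarith)]; linarith
    gcongr
    linarith
  have hN0 : 0 < N := hR.trans_le hRN
  set D := √(P ^ 2 * ‖β‖ ^ 2 - R ^ 2) with hD
  have hDsq : D ^ 2 = N ^ 2 - R ^ 2 := by
    rw [hD, Real.sq_sqrt, hN]
    · ring
    · rw [← mul_pow, ← hN, sub_nonneg]; gcongr
  have hD0 : 0 ≤ D := Real.sqrt_nonneg _
  -- `ρ = R₂ / R₁` is a root of `R * (1 + ρ ^ 2) = 2 * N * ρ`; the estimates use only this equation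
  -- and `0 < ρ ≤ 1`.
  set ρ := R / (N + D) with hρ
  have hρ0 : 0 < ρ := by positivity
  have hρ1 : ρ ≤ 1 := by rw [hρ, div_le_one (by positivity)]; linarith
  have hquad : R * (1 + ρ ^ 2) = 2 * N * ρ := by
    have : N + D ≠ 0 := by positivity
    rw [hρ]
    field_simp
    linear_combination hDsq
  have hR2 : radiusR₂ α β = P * ρ := by
    rw [radiusR₂, hρ]
    ring
  rw [hR2]
  refine ⟨by positivity, ?_⟩
  rw [hβ]
  have hfac : ∀ x y : ℝ, x * (‖α‖ * B + ‖α‖ * y) = ‖α‖ * (x * (B + y)) := fun x y => by ring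
  rw [hfac]
  by_cases h : 3 / 4 < (β / α).re
  · have hP1 : P = 1 := by rw [hP, radiusR₁, if_pos h]
    have hR' : R = ‖α‖ * (1 / 2 - paramM α β) := by rw [hRdef, radiusR, if_pos h]
    obtain ⟨h1, h2⟩ := covering_estimate_large (c := 1 / 2 - paramM α β) (B := B) hρ0 hρ1
      (by linarith) (by
        refine mul_left_cancel₀ hα'.ne' ?_
        rw [hR', hN, hP1, hβ] at hquad
        linear_combination hquad)
    rw [hP1, one_mul]
    exact ⟨h1, by rw [hR']; gcongr⟩
  · have hP1 : P = 1 / √(paramM α β) - 1 := by rw [hP, radiusR₁, if_neg h]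
    have hR' : R = ‖α‖ * (1 - √(paramM α β)) ^ 2 := by rw [hRdef, radiusR, if_neg h]
    have hM : 1 / 4 ≤ paramM α β := by rw [paramM]; linarith
    have hM1 : paramM α β < 1 := by rw [paramM]; linarith
    have hsq : √(paramM α β) ^ 2 = paramM α β := Real.sq_sqrt (by linarith)
    have hnn := Real.sqrt_nonneg (paramM α β)
    set μ := √(paramM α β) with hμ
    have hμ1 : 1 / 2 ≤ μ := by nlinarith
    have hμ2 : μ < 1 := by nlinarith
    obtain ⟨h1, h2⟩ := covering_estimate_small (B := B) hμ1 hμ2 hρ0 hρ1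
      (by rw [hsq]; exact hbB) (by
        have hμ0 : μ ≠ 0 := by linarith
        have h1μ : 1 - μ ≠ 0 := by linarith
        refine mul_left_cancel₀ (mul_ne_zero hα'.ne' h1μ) ?_
        rw [hR', hN, hP1, hβ] at hquad
        field_simp at hquad ⊢
        linear_combination hquad)
    refine ⟨by rw [hP1]; exact h1, ?_⟩
    rw [hR', hP1]
    gcongr

end Estimates

/-! ### Inversion and covering for members of the class. -/

section ClassA

variable {α β : ℂ} {F : ℂ → ℂ}

lemma classA_factor (hα : α ≠ 0) (hF : F ∈ classA α β) :
    ∃ p : ℂ → ℂ, DifferentiableOn ℂ p (ball 0 1) ∧ p 0 = β ∧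
      ∀ z ∈ ball (0 : ℂ) 1, F z = z * p z ∧
        ‖α‖ * (1 / (1 + ‖z‖) - paramM α β) ≤ ‖p z‖ ∧
        ‖p z‖ ≤ ‖β‖ + ‖α‖ * (‖z‖ / (1 - ‖z‖)) := by
  obtain ⟨-, ω, ⟨hd, hmaps, h0⟩, hFω⟩ := hF
  refine ⟨fun z => psi α β (ω z), ?_, by simp [psi, h0], fun z hz => ?_⟩
  · have hne : ∀ z ∈ ball (0 : ℂ) 1, 1 - ω z ≠ 0 := fun z hz h => by
      have h1 := hmaps hz
      rw [← sub_eq_zero.1 h] at h1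
      simp at h1
    exact ((hd.const_mul α).div (hd.const_sub 1) hne).const_add β
  · have hz' : ‖z‖ < 1 := by simpa using hz
    have hω : ‖ω z‖ ≤ ‖z‖ := Complex.norm_le_norm_of_mapsTo_ball hd
      (hmaps.mono_right ball_subset_closedBall) h0 hz'
    exact ⟨hFω z hz, norm_psi_ge hα hω hz', norm_psi_le hω hz'⟩

lemma classA_apply_zero (hF : F ∈ classA α β) : F 0 = 0 := by
  obtain ⟨-, ω, -, hFω⟩ := hF
  simpa using hFω 0 (by simp)

lemma classA_hasStrictDerivAt (hα : α ≠ 0) (hF : F ∈ classA α β) : HasStrictDerivAt F β 0 := by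
  obtain ⟨p, hp, hp0, hFp⟩ := classA_factor hα hF
  have hnhds : ball (0 : ℂ) 1 ∈ 𝓝 0 := ball_mem_nhds _ one_pos
  have h1 : HasDerivAt (fun z => z * p z) β 0 := by
    simpa [hp0] using (hasDerivAt_id' (0 : ℂ)).fun_mul (hp.differentiableAt hnhds).hasDerivAt
  have h2 : HasDerivAt F β 0 := h1.congr_of_eventuallyEq <| by
    filter_upwards [hnhds] with z hz using (hFp z hz).1
  rw [← h2.deriv]
  exact (hF.1.analyticAt hnhds).hasStrictDerivAt

/-- Every member of the class has a holomorphic right inverse on the disk of radius `R`. -/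
lemma exists_rightInverse (hα : α ≠ 0) (hb : 0 < (β / α).re) (hF : F ∈ classA α β) :
    ∃ H : ℂ → ℂ, DifferentiableOn ℂ H (ball 0 (radiusR α β)) ∧ H 0 = 0 ∧
      ∀ w ∈ ball (0 : ℂ) (radiusR α β), H w ∈ ball (0 : ℂ) (radiusR₁ α β) ∧ F (H w) = w := by
  obtain ⟨hR1, hR1', hR, hrel⟩ := param_pos hα hb
  obtain ⟨p, hp, -, hFp⟩ := classA_factor hα hF
  have hsub : ball (0 : ℂ) (radiusR₁ α β) ⊆ ball 0 1 := ball_subset_ball hR1'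
  have hlow : ∀ z ∈ ball (0 : ℂ) (radiusR₁ α β), radiusR α β / radiusR₁ α β ≤ ‖p z‖ :=
    fun z hz => by
      refine le_trans ?_ (hFp z (hsub hz)).2.1
      have : ‖z‖ ≤ radiusR₁ α β := by simpa using (mem_ball.1 hz).le
      rw [hrel]
      gcongr
  have hne : ∀ z ∈ ball (0 : ℂ) (radiusR₁ α β), p z ≠ 0 := fun z hz =>
    norm_pos_iff.1 ((div_pos hR hR1).trans_le (hlow z hz))
  obtain ⟨H, hH, hHq⟩ := exists_holomorphic_fixedPoint (q := fun z => (p z)⁻¹) hR1 hR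
    (fun z hz => by
      rw [norm_inv, ← inv_div]
      exact inv_anti₀ (div_pos hR hR1) (hlow z hz)) ((hp.mono hsub).inv hne)
  refine ⟨H, hH, ?_, fun w hw => ⟨(hHq w hw).1, ?_⟩⟩
  · simpa using (hHq 0 (mem_ball_self hR)).2
  · have hm := (hHq w hw).1
    rw [(hFp _ (hsub hm)).1]
    calc H w * p (H w) = w * (p (H w))⁻¹ * p (H w) := by rw [← (hHq w hw).2]
      _ = w := by rw [mul_assoc, inv_mul_cancel₀ (hne _ hm), mul_one]

lemma classA_mapsTo_ball (hα : α ≠ 0) (hb : 0 < (β / α).re) (hF : F ∈ classA α β) :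
    MapsTo F (ball 0 (radiusR₂ α β)) (ball 0 (radiusR α β)) := fun z hz => by
  obtain ⟨hpos, hlt1, hest⟩ := radiusR₂_spec hα hb
  obtain ⟨p, -, -, hFp⟩ := classA_factor hα hF
  have hz' : ‖z‖ < radiusR₂ α β := by simpa using hz
  have hz1 : ‖z‖ < 1 := hz'.trans hlt1
  have hβ : 0 < ‖β‖ := norm_pos_iff.2 fun h => by simp [h] at hb
  obtain ⟨h1, -, h2⟩ := hFp z (by simpa using hz1)
  rw [mem_ball_zero_iff, h1, norm_mul]
  have hlt1' : 0 < 1 - radiusR₂ α β := by linarith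
  calc ‖z‖ * ‖p z‖ ≤ ‖z‖ * (‖β‖ + ‖α‖ * (‖z‖ / (1 - ‖z‖))) := by gcongr
    _ ≤ ‖z‖ * (‖β‖ + ‖α‖ * (radiusR₂ α β / (1 - radiusR₂ α β))) := by gcongr
    _ < radiusR₂ α β * (‖β‖ + ‖α‖ * (radiusR₂ α β / (1 - radiusR₂ α β))) := by gcongr
    _ ≤ radiusR α β := hest

/-- Near `0`, `F' z = F (G (F' z)) = F z`; the identity theorem does the rest. Thus `G` determines
`F` on the unit disk, and an extension built from one `F` serves all. -/
lemma classA_eqOn {F' G : ℂ → ℂ} (hF : F ∈ classA α β) (hF' : F' ∈ classA α β)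
    (hG : IsInverseAtZero F G) (hG' : IsInverseAtZero F' G) : EqOn F F' (ball 0 1) := by
  refine (hF.1.analyticOnNhd isOpen_ball).eqOn_of_preconnected_of_eventuallyEq
    (hF'.1.analyticOnNhd isOpen_ball) (convex_ball 0 1).isPreconnected
    (mem_ball_self one_pos) ?_
  have ht : Tendsto F' (𝓝 0) (𝓝 0) := by
    have := (hF'.1.continuousOn.continuousAt (ball_mem_nhds (0 : ℂ) one_pos)).tendsto
    rwa [classA_apply_zero hF'] at this
  filter_upwards [ht.eventually hG.2.2.1, hG'.2.2.2] with z h1 h2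
  rw [h2] at h1
  exact h1

end ClassA

end InverseClass

theorem mainTheorem6 (α β : ℂ) (hαβ : 0 < (α * (starRingEnd ℂ) β).re) :
    -- every member of the class has an inverse near the origin
    (∀ F ∈ InverseClass.classA α β, ∃ G : ℂ → ℂ, InverseClass.IsInverseAtZero F G) ∧
    -- every inverse `G` extends to a univalent function `H` on the disk of radius `R`
    (∀ G ∈ InverseClass.classB α β, ∃ H : ℂ → ℂ,
      H =ᶠ[𝓝 0] G ∧
      DifferentiableOn ℂ H (ball 0 (InverseClass.radiusR α β)) ∧
      InjOn H (ball 0 (InverseClass.radiusR α β)) ∧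
      -- `H` is still the inverse, on the whole disk, of each `F` that `G` inverts near `0`
      (∀ F ∈ InverseClass.classA α β, InverseClass.IsInverseAtZero F G →
        ∀ w ∈ ball (0 : ℂ) (InverseClass.radiusR α β), F (H w) = w) ∧
      H '' ball 0 (InverseClass.radiusR α β) ⊆ ball 0 (InverseClass.radiusR₁ α β) ∧
      ball 0 (InverseClass.radiusR₂ α β) ⊆ H '' ball 0 (InverseClass.radiusR α β)) := by
  have hα : α ≠ 0 := by rintro rfl; simp at hαβ
  have hb : 0 < (β / α).re := by
    rw [Complex.div_re, ← add_div]
    refine div_pos ?_ (Complex.normSq_pos.2 hα)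
    simp only [Complex.mul_re, Complex.conj_re, Complex.conj_im] at hαβ
    linarith
  have hβ : β ≠ 0 := by rintro rfl; simp at hb
  obtain ⟨-, hR1', hR, -⟩ := InverseClass.param_pos hα hb
  refine ⟨fun F hF => ?_, ?_⟩
  · obtain ⟨H, hHd, hH0, hH⟩ := InverseClass.exists_rightInverse hα hb hF
    obtain ⟨g, hg⟩ := InverseClass.exists_localInverse_unique hβ
      (InverseClass.classA_hasStrictDerivAt hα hF) (InverseClass.classA_apply_zero hF)
    have hright : ∀ᶠ w in 𝓝 (0 : ℂ), F (H w) = w := by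
      filter_upwards [ball_mem_nhds _ hR] with w hw using (hH w hw).2
    have han : AnalyticAt ℂ H 0 := hHd.analyticAt (ball_mem_nhds _ hR)
    exact ⟨H, han, hH0, hright, (hg H han.continuousAt hH0 hright).2⟩
  · rintro G ⟨F, hF, hG⟩
    obtain ⟨H, hHd, hH0, hH⟩ := InverseClass.exists_rightInverse hα hb hF
    obtain ⟨g, hg⟩ := InverseClass.exists_localInverse_unique hβ
      (InverseClass.classA_hasStrictDerivAt hα hF) (InverseClass.classA_apply_zero hF)
    have hHg := hg H (hHd.continuousOn.continuousAt (ball_mem_nhds _ hR)) hH0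
      (by filter_upwards [ball_mem_nhds _ hR] with w hw using (hH w hw).2)
    have hGg := hg G hG.1.continuousAt hG.2.1 hG.2.2.1
    refine ⟨H, hHg.1.trans hGg.1.symm, hHd, fun w hw w' hw' h => ?_, fun F' hF' hG' w hw => ?_,
      ?_, fun z hz => ?_⟩
    · rw [← (hH w hw).2, ← (hH w' hw').2, h]
    · rw [← InverseClass.classA_eqOn hF hF' hG hG' (ball_subset_ball hR1' (hH w hw).1)]
      exact (hH w hw).2
    · rintro _ ⟨w, hw, rfl⟩
      exact (hH w hw).1
    · obtain ⟨hR2, hR2', -⟩ := InverseClass.radiusR₂_spec hα hb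
      have hmaps := InverseClass.classA_mapsTo_ball hα hb hF
      have hHF : EqOn (H ∘ F) id (ball 0 (InverseClass.radiusR₂ α β)) :=
        ((hHd.comp (hF.1.mono (ball_subset_ball hR2'.le)) hmaps).analyticOnNhd
          isOpen_ball).eqOn_of_preconnected_of_eventuallyEq analyticOnNhd_id
          (convex_ball 0 _).isPreconnected (mem_ball_self hR2) hHg.2
      exact ⟨F z, hmaps hz, hHF hz⟩
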